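/- Let $\mathcal H$ be a separable infinite-dimensional complex Hilbert space, let $Z$ be an uncountable standard Borel space, and for every $[\psi]$ in the projective space $\mathbb P(\mathcal H)$ let $\mu_{[\psi]}$ be a probability measure on $Z$ with $\mu_{[\psi]}(\{z\})=0$ for all $z\in Z$. Let $A$ be a self-adjoint (or essentially self-adjoint), possibly unbounded, operator on $\mathcal H$, and let $E^A$ be its spectral measure, i.e. the projection-valued measure on the Borel sets of $\mathbb R$ with $\overline{A}=\int r\,dE^A(r)$. For a unit vector $\psi$ write $\langle T\rangle_\psi=\langle\psi,T\psi\rangle$, and put $F^A_\psi(r)=\langle E^A_{(-\infty,r]}\rangle_\psi$ for $r\in\mathbb R$. Let $\nu_{F^A_\psi}$ be the Borel measure on $\mathbb R$ with $\nu_{F^A_\psi}((a,b])=F^A_\psi(b)-F^A_\psi(a)$ for $a\le b$, and let $(F^A_\psi)^{(-1)}(s)=\min\{r\in\mathbb R: F^A_\psi(r)\ge s\}$ for $0<s<1$. Let $\alpha_{[\psi]}:Z\to(0,1)$ be a barrier for $[\psi]$, i.e. a Borel function with $(\alpha_{[\psi]})_*\mu_{[\psi]}=\lambda$, the Lebesgue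 measure on $(0,1)$, and define $\widehat A_{\alpha[\psi]}:Z\to\mathbb R$ by $$\widehat A_{\alpha[\psi]}(z)=\min\{r\in\mathbb R:\ \langle E^A_{(-\infty,r]}\rangle_\psi\ge\alpha_{[\psi]}(z)\}.$$ Then this minimum exists for every $z\in Z$, and: 1. $\widehat A_{\alpha[\psi]}=(F^A_\psi)^{(-1)}\circ\alpha_{[\psi]}$ is a Borel function; 2. $(\widehat A_{\alpha[\psi]})_*\mu_{[\psi]}=\nu_{F^A_\psi}$; that is, $\mu_{[\psi]}\big(\widehat A_{\alpha[\psi]}^{-1}(B)\big)=\langle E^A_B\rangle_\psi$ for every Borel set $B\subseteq\mathbb R$. -/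

import Mathlib

open MeasureTheory Set
open scoped InnerProductSpace ENNReal

namespace HiddenValues

noncomputable section

variable {H : Type*} [NormedAddCommGroup H] [InnerProductSpace ℂ H] [CompleteSpace H]

/-- A projection-valued measure on the Borel sets of `ℝ`: orthogonal projections `E B`,
with `E ℝ = 1`, countably additive in the strong operator topology.  As for Mathlib's
vector measures, the (meaningless) value on a non-measurable set is fixed to be `0`. -/
structure PVM (H : Type*) [NormedAddCommGroup H] [InnerProductSpace ℂ H] [CompleteSpace H] where
  proj : Set ℝ → (H →L[ℂ] H)
  isStarProjection : ∀ B, MeasurableSet B → IsStarProjection (proj B)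
  not_measurable : ∀ B, ¬ MeasurableSet B → proj B = 0
  proj_univ : proj univ = 1
  hasSum_iUnion : ∀ B : ℕ → Set ℝ, (∀ n, MeasurableSet (B n)) →
    Pairwise (Function.onFun Disjoint B) →
    ∀ x : H, HasSum (fun n => proj (B n) x) (proj (⋃ n, B n) x)

namespace PVM

theorem proj_empty (E : PVM H) : E.proj ∅ = 0 := by
  ext x
  have h := E.hasSum_iUnion (fun _ => ∅) (fun _ => MeasurableSet.empty)
    (fun _ _ _ => disjoint_bot_left) x
  have h2 := h.summable.tendsto_atTop_zero
  simpa using tendsto_nhds_unique tendsto_const_nhds h2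

theorem re_inner_nonneg (E : PVM H) (x : H) (B : Set ℝ) : 0 ≤ (⟪x, E.proj B x⟫_ℂ).re := by
  by_cases hB : MeasurableSet B
  · have h := (ContinuousLinearMap.nonneg_iff_isPositive _).mp
      (E.isStarProjection B hB).nonneg
    exact h.re_inner_nonneg_right x
  · simp [E.not_measurable B hB]

/-- The scalar measure `B ↦ ⟪x, E_B x⟫` of a vector `x`. -/
def scalar (E : PVM H) (x : H) : Measure ℝ :=
  Measure.ofMeasurable (fun B _ => ENNReal.ofReal (⟪x, E.proj B x⟫_ℂ).re)
    (by simp [E.proj_empty])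
    (by
      intro B hB hd
      have h := E.hasSum_iUnion B hB hd x
      have h2 : HasSum (fun n => (⟪x, E.proj (B n) x⟫_ℂ).re)
          (⟪x, E.proj (⋃ n, B n) x⟫_ℂ).re :=
        Complex.hasSum_re (h.mapL (innerSL ℂ x))
      rw [← h2.tsum_eq]
      exact ENNReal.ofReal_tsum_of_nonneg (fun n => E.re_inner_nonneg x _) h2.summable)

theorem scalar_apply (E : PVM H) (x : H) {B : Set ℝ} (hB : MeasurableSet B) :
    E.scalar x B = ENNReal.ofReal (⟪x, E.proj B x⟫_ℂ).re :=
  Measure.ofMeasurable_apply B hB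

open scoped Classical in
/-- The projection-valued measure concentrated at the point `0`. -/
instance : Nonempty (PVM H) :=
  ⟨{ proj := fun B => if MeasurableSet B ∧ (0 : ℝ) ∈ B then 1 else 0
     isStarProjection := by
       intro B _
       split_ifs
       · exact IsStarProjection.one _
       · exact IsStarProjection.zero _
     not_measurable := by
       intro B hB
       simp [hB]
     proj_univ := by simp
     hasSum_iUnion := by
       intro B hB hd x
       by_cases h : ∃ n, (0 : ℝ) ∈ B n
       · obtain ⟨n, hn⟩ := h
         have h1 : (0 : ℝ) ∈ ⋃ n, B n := mem_iUnion.2 ⟨n, hn⟩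
         rw [if_pos ⟨MeasurableSet.iUnion hB, h1⟩]
         have := hasSum_single (f := fun m =>
           (if MeasurableSet (B m) ∧ (0 : ℝ) ∈ B m then (1 : H →L[ℂ] H) else 0) x) n (by
             intro m hm
             have : (0 : ℝ) ∉ B m := fun h0 => (disjoint_left.1 (hd hm)) h0 hn
             simp [this])
         simpa [hB n, hn] using this
       · have h1 : (0 : ℝ) ∉ ⋃ n, B n := by simpa using h
         have h2 : ∀ n, (0 : ℝ) ∉ B n := by simpa using h
         simp only [h1, h2, and_false, if_false]
         simp }⟩

/-- `E` is the spectral measure of the (unbounded) operator `A`, i.e. `A = ∫ r dE(r)`: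
the domain of `A` is `{x | ∫ r² d⟪x, E x⟫ < ∞}`, and `⟪x, A x⟫ = ∫ r d⟪x, E x⟫` on it. -/
def IsSpectralMeasureOf (E : PVM H) (A : H →ₗ.[ℂ] H) : Prop :=
  (∀ x : H, x ∈ A.domain ↔ ∫⁻ r, ENNReal.ofReal (r ^ 2) ∂(E.scalar x) < ∞) ∧
  ∀ x : A.domain, ⟪(x : H), A x⟫_ℂ = ((∫ r, r ∂(E.scalar (x : H)) : ℝ) : ℂ)

end PVM

/-- An operator is essentially self-adjoint if it is closable with self-adjoint closure. -/
def IsEssentiallySelfAdjoint (A : H →ₗ.[ℂ] H) : Prop :=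
  A.IsClosable ∧ IsSelfAdjoint A.closure

/-- A self-adjoint operator is its own closure. -/
theorem closure_eq_self {A : H →ₗ.[ℂ] H} (hA : IsSelfAdjoint A) : A.closure = A := by
  have hc : A.IsClosed := hA.isClosed
  apply LinearPMap.eq_of_eq_graph
  rw [← hc.isClosable.graph_closure_eq_closure_graph]
  exact IsClosed.submodule_topologicalClosure_eq hc

/-- Self-adjoint operators are essentially self-adjoint. -/
theorem isEssentiallySelfAdjoint {A : H →ₗ.[ℂ] H} (hA : IsSelfAdjoint A) :
    IsEssentiallySelfAdjoint A :=
  ⟨hA.isClosed.isClosable, by rwa [closure_eq_self hA]⟩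

/-- The spectral measure `E^A` of an (essentially) self-adjoint operator: the
projection-valued measure `E` with `closure A = ∫ r dE(r)`. -/
def spectralMeasure (A : H →ₗ.[ℂ] H) : PVM H :=
  Classical.epsilon fun E : PVM H => E.IsSpectralMeasureOf A.closure

/-- The expected value `⟨T⟩_ψ` of a bounded operator on a pure state `[ψ]`: it is
`re ⟪ψ, T ψ⟫` for a unit vector `ψ`. -/
def expect (T : H →L[ℂ] H) : Projectivization ℂ H → ℝ :=
  Projectivization.lift (fun v : {v : H // v ≠ 0} => (⟪v.1, T v.1⟫_ℂ).re / ‖v.1‖ ^ 2) (by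
    rintro ⟨a, ha⟩ ⟨b, hb⟩ t h
    simp only at h
    subst h
    have ht : t ≠ 0 := fun h0 => ha (by simp [h0])
    have ht' : ‖t‖ ≠ 0 := norm_ne_zero_iff.2 ht
    have hb' : ‖b‖ ≠ 0 := norm_ne_zero_iff.2 hb
    have h1 : ⟪t • b, T (t • b)⟫_ℂ = ((‖t‖ ^ 2 : ℝ) : ℂ) * ⟪b, T b⟫_ℂ := by
      rw [map_smul, inner_smul_left, inner_smul_right, ← mul_assoc, Complex.conj_mul']
      push_cast
      rfl
    simp only [h1, Complex.re_ofReal_mul, norm_smul]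
    field_simp)

theorem expect_mk (T : H →L[ℂ] H) {ψ : H} (hψ : ‖ψ‖ = 1) (h0 : ψ ≠ 0) :
    expect T (Projectivization.mk ℂ ψ h0) = (⟪ψ, T ψ⟫_ℂ).re := by
  simp [expect, Projectivization.lift_mk, hψ]

/-- The function `F_ψ^A(r) = ⟨E^A_{(-∞, r]}⟩_ψ`. -/
def cumulative (A : H →ₗ.[ℂ] H) (p : Projectivization ℂ H) (r : ℝ) : ℝ :=
  expect ((spectralMeasure A).proj (Iic r)) p

/-- The quasi-inverse `F^(-1)(s) = min {r | F r ≥ s}`, for `s ∈ ]0,1[`. -/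
def quasiInverse (F : ℝ → ℝ) (s : Ioo (0 : ℝ) 1) : ℝ :=
  sInf {r : ℝ | F r ≥ (s : ℝ)}

open scoped Classical in
/-- The Borel measure `ν_F` with `ν_F ]a,b] = F b - F a`, for `F` non-decreasing and
right-continuous (and `0` by convention for any other `F`). -/
def nu (F : ℝ → ℝ) : Measure ℝ :=
  if h : Monotone F ∧ ∀ x, ContinuousWithinAt F (Ici x) x then
    StieltjesFunction.measure ⟨F, h.1, h.2⟩
  else 0

variable {Z : Type*} [MeasurableSpace Z]

/-- A probability barrier for the state `p`: a Borel map `α : Z → ]0,1[` which carries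
`μ_p` to the Lebesgue measure of `]0,1[`. -/
structure Barrier (μ : Projectivization ℂ H → Measure Z) (p : Projectivization ℂ H) where
  toFun : Z → Ioo (0 : ℝ) 1
  measurable : Measurable toFun
  map_eq : (μ p).map toFun = (volume : Measure ℝ).comap Subtype.val

/-- A complete pure state `([ψ], α, z)`. -/
structure CompleteState (μ : Projectivization ℂ H → Measure Z) where
  state : Projectivization ℂ H
  barrier : Barrier μ state
  label : Z

/-- The values function `v(A; [ψ], α, z) = min {r | ⟨E^A_{(-∞, r]}⟩_ψ ≥ α(z)}`. -/
def value {μ : Projectivization ℂ H → Measure Z} (A : H →ₗ.[ℂ] H) (c : CompleteState μ) : ℝ :=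
  sInf {r : ℝ | expect ((spectralMeasure A).proj (Iic r)) c.state ≥ (c.barrier.toFun c.label : ℝ)}

/-- The values function of `A` with the state and the barrier fixed. -/
def observable {μ : Projectivization ℂ H → Measure Z} (A : H →ₗ.[ℂ] H)
    (p : Projectivization ℂ H) (α : Barrier μ p) (z : Z) : ℝ :=
  value A (⟨p, α, z⟩ : CompleteState μ)

end

end HiddenValues

namespace HiddenValues

section QuasiInverse

open ProbabilityTheory

variable (m : Measure ℝ)

/-! This is inverse transform sampling. For a unit vector `ψ`, countable additivity of the spectral
measure and `E ℝ = 1` make `B ↦ ⟨E_B⟩_ψ` a probability measure `m` on `ℝ`, and `cumulative A p` is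
its distribution function. The quasi-inverse of `cdf m` satisfies the Galois relation `quasiInverse
(cdf m) s ≤ r ↔ s ≤ cdf m r`. It is therefore Borel, and it carries Lebesgue measure on `]0,1[` to a
measure that agrees with `m` on all half-lines, hence to `m`. The barrier carries `μ p` to Lebesgue
measure, so the composite carries `μ p` to `m`. -/

/-- The quasi-inverse of a distribution function is an attained minimum. -/
theorem isLeast_quasiInverse_cdf (s : Ioo (0 : ℝ) 1) :
    IsLeast {r : ℝ | cdf m r ≥ (s : ℝ)} (quasiInverse (cdf m) s) := by
  -- The limits 1 and 0 of `cdf m` at `±∞`, against `0 < s < 1`, make the set nonempty and bounded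
  -- below, so `sInf` is a true infimum and not the default 0.
  have hne : {r : ℝ | cdf m r ≥ (s : ℝ)}.Nonempty :=
    ((tendsto_cdf_atTop m).eventually_const_le s.2.2).exists
  have hbdd : BddBelow {r : ℝ | cdf m r ≥ (s : ℝ)} := by
    obtain ⟨a, ha⟩ := ((tendsto_cdf_atBot m).eventually_lt_const s.2.1).exists
    refine ⟨a, fun r hr => le_of_not_gt fun h => ?_⟩
    exact absurd ((hr : (s : ℝ) ≤ cdf m r).trans (monotone_cdf m h.le)) (not_le.2 ha)
  refine ⟨?_, fun r hr => csInf_le hbdd hr⟩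
  -- Attainment is right-continuity: `cdf m ≥ s` at every point strictly beyond the infimum, so the
  -- limit from the right is also at least `s`.
  have hright : Filter.Tendsto (cdf m) (nhdsWithin (quasiInverse (cdf m) s)
      (Ioi (quasiInverse (cdf m) s))) (nhds (cdf m (quasiInverse (cdf m) s))) :=
    ((cdf m).right_continuous _).mono_left (nhdsWithin_mono _ Ioi_subset_Ici_self)
  refine ge_of_tendsto hright ?_
  filter_upwards [self_mem_nhdsWithin] with r hr
  obtain ⟨t, ht, htr⟩ := exists_lt_of_csInf_lt hne hr
  exact (ht : (s : ℝ) ≤ cdf m t).trans (monotone_cdf m htr.le)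

theorem quasiInverse_cdf_le_iff (s : Ioo (0 : ℝ) 1) (r : ℝ) :
    quasiInverse (cdf m) s ≤ r ↔ (s : ℝ) ≤ cdf m r :=
  ⟨fun h => (isLeast_quasiInverse_cdf m s).1.trans (monotone_cdf m h),
    fun h => (isLeast_quasiInverse_cdf m s).2 h⟩

theorem preimage_quasiInverse_cdf_Iic (r : ℝ) :
    quasiInverse (cdf m) ⁻¹' Iic r = Subtype.val ⁻¹' Iic (cdf m r) :=
  Set.ext fun s => quasiInverse_cdf_le_iff m s r

theorem measurable_quasiInverse_cdf : Measurable (quasiInverse (cdf m)) :=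
  measurable_of_Iic fun r => by
    rw [preimage_quasiInverse_cdf_Iic]
    exact measurable_subtype_coe measurableSet_Iic

variable [IsProbabilityMeasure m]

/-- The quasi-inverse of a distribution function carries the Lebesgue measure of `]0,1[` to
the distribution. -/
theorem map_quasiInverse_cdf :
    ((volume : Measure ℝ).comap (Subtype.val : Ioo (0 : ℝ) 1 → ℝ)).map
      (quasiInverse (cdf m)) = m := by
  have hIic (r : ℝ) : ((volume : Measure ℝ).comap (Subtype.val : Ioo (0 : ℝ) 1 → ℝ)).map
      (quasiInverse (cdf m)) (Iic r) = m (Iic r) := by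
    rw [Measure.map_apply (measurable_quasiInverse_cdf m) measurableSet_Iic,
      preimage_quasiInverse_cdf_Iic,
      (MeasurableEmbedding.subtype_coe measurableSet_Ioo).comap_apply,
      Subtype.image_preimage_coe, ← ofReal_cdf m r]
    -- Adding the null point 1 makes the intersection the single interval `Ioc 0 (cdf m r)`,
    -- including when `cdf m r = 1`.
    have hae : (Ioo (0 : ℝ) 1 ∩ Iic (cdf m r) : Set ℝ) =ᵐ[volume]
        (Ioc (0 : ℝ) 1 ∩ Iic (cdf m r) : Set ℝ) :=
      Ioo_ae_eq_Ioc.inter (ae_eq_refl _)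
    rw [measure_congr hae, Ioc_inter_Iic, min_eq_right (cdf_le_one m r), Real.volume_Ioc,
      sub_zero]
  -- Half-lines determine a measure only under finiteness, which the pushforward inherits from this
  -- one.
  have : IsFiniteMeasure ((volume : Measure ℝ).comap (Subtype.val : Ioo (0 : ℝ) 1 → ℝ)) :=
    ⟨by
      rw [(MeasurableEmbedding.subtype_coe measurableSet_Ioo).comap_apply]
      rw [image_univ, Subtype.range_coe, Real.volume_Ioo]
      exact ENNReal.ofReal_lt_top⟩
  exact Measure.ext_of_Iic _ _ hIic

theorem nu_cdf : nu (cdf m) = m := by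
  rw [nu, dif_pos ⟨monotone_cdf m, (cdf m).right_continuous⟩]
  exact measure_cdf m

end QuasiInverse

section Scalar

variable {H : Type*} [NormedAddCommGroup H] [InnerProductSpace ℂ H]

/-- Every pure state is represented by a unit vector. -/
theorem exists_unit_representative (p : Projectivization ℂ H) :
    ∃ (ψ : H) (h0 : ψ ≠ 0), ‖ψ‖ = 1 ∧ Projectivization.mk ℂ ψ h0 = p := by
  have hr := norm_ne_zero_iff.2 p.rep_nonzero
  have hc : ((‖p.rep‖ : ℂ)⁻¹) ≠ 0 := inv_ne_zero (Complex.ofReal_ne_zero.2 hr)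
  refine ⟨(‖p.rep‖ : ℂ)⁻¹ • p.rep, smul_ne_zero hc p.rep_nonzero, ?_, ?_⟩
  · simp [norm_smul, hr]
  · conv_rhs => rw [← p.mk_rep]
    exact (Projectivization.mk_eq_mk_iff' ℂ _ _ _ _).2 ⟨_, rfl⟩

variable [CompleteSpace H]

theorem PVM.isProbabilityMeasure_scalar (E : PVM H) {ψ : H} (hψ : ‖ψ‖ = 1) :
    IsProbabilityMeasure (E.scalar ψ) :=
  ⟨by
    rw [E.scalar_apply ψ MeasurableSet.univ, E.proj_univ, one_apply_eq_self,
      inner_self_eq_norm_sq_to_K, hψ]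
    simp⟩

/-- The quantum mechanical probabilities `B ↦ ⟨E_B⟩` in a pure state form a probability
measure. -/
theorem PVM.exists_isProbabilityMeasure_expect (E : PVM H) (p : Projectivization ℂ H) :
    ∃ m : Measure ℝ, IsProbabilityMeasure m ∧
      ∀ B, MeasurableSet B → m B = ENNReal.ofReal (expect (E.proj B) p) ∧
        m.real B = expect (E.proj B) p := by
  obtain ⟨ψ, h0, hψ, rfl⟩ := exists_unit_representative p
  refine ⟨E.scalar ψ, E.isProbabilityMeasure_scalar hψ, fun B hB => ?_⟩
  rw [expect_mk _ hψ, measureReal_def, E.scalar_apply ψ hB]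
  exact ⟨rfl, ENNReal.toReal_ofReal (E.re_inner_nonneg ψ B)⟩

end Scalar

end HiddenValues

theorem mainTheorem4
    {H : Type*} [NormedAddCommGroup H] [InnerProductSpace ℂ H] [CompleteSpace H]
    [TopologicalSpace.SeparableSpace H] (hH : ¬ FiniteDimensional ℂ H)
    {Z : Type*} [MeasurableSpace Z] [StandardBorelSpace Z] [Uncountable Z]
    (μ : Projectivization ℂ H → Measure Z)
    (hμ : ∀ p, IsProbabilityMeasure (μ p)) (hμ_atoms : ∀ p, NullSingletonClass (μ p))
    (A : H →ₗ.[ℂ] H) (hA : HiddenValues.IsEssentiallySelfAdjoint A)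
    (p : Projectivization ℂ H) (α : HiddenValues.Barrier μ p) :
    -- the minimum that defines the value is attained
    (∀ z, IsLeast {r : ℝ | HiddenValues.cumulative A p r ≥ (α.toFun z : ℝ)}
      (HiddenValues.observable A p α z)) ∧
    HiddenValues.observable A p α =
      HiddenValues.quasiInverse (HiddenValues.cumulative A p) ∘ α.toFun ∧
    Measurable (HiddenValues.observable A p α) ∧
    (μ p).map (HiddenValues.observable A p α) =
      HiddenValues.nu (HiddenValues.cumulative A p) ∧
    -- the quantum mechanical probabilities are reproduced
    ∀ B : Set ℝ, MeasurableSet B →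
      μ p (HiddenValues.observable A p α ⁻¹' B) =
        ENNReal.ofReal (HiddenValues.expect ((HiddenValues.spectralMeasure A).proj B) p) := by
  obtain ⟨m, hm, hmB⟩ :=
    (HiddenValues.spectralMeasure A).exists_isProbabilityMeasure_expect p
  have hF : HiddenValues.cumulative A p = ProbabilityTheory.cdf m := by
    ext r
    rw [ProbabilityTheory.cdf_eq_real, (hmB _ measurableSet_Iic).2]
    rfl
  -- Both sides unfold to the `sInf` of the same set.
  have hobs : HiddenValues.observable A p α =
      HiddenValues.quasiInverse (HiddenValues.cumulative A p) ∘ α.toFun := rfl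
  have hmap : (μ p).map (HiddenValues.observable A p α) = m := by
    -- Two successive pushforwards: `μ p` to Lebesgue measure by the barrier, then to `m` by the
    -- quasi-inverse.
    rw [hobs, hF, ← Measure.map_map (HiddenValues.measurable_quasiInverse_cdf m) α.measurable,
      α.map_eq, HiddenValues.map_quasiInverse_cdf]
  have hmeas : Measurable (HiddenValues.observable A p α) := by
    rw [hobs, hF]
    exact (HiddenValues.measurable_quasiInverse_cdf m).comp α.measurable
  refine ⟨fun z => ?_, hobs, hmeas, ?_, fun B hB => ?_⟩
  · rw [hobs, hF]
    exact HiddenValues.isLeast_quasiInverse_cdf m (α.toFun z)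
  · rw [hmap, hF, HiddenValues.nu_cdf]
  · rw [← Measure.map_apply hmeas hB, hmap, (hmB B hB).1]
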